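/- **Setup.** Let $a(n)\ge 0$ $(n\ge 1)$ be a sequence of real numbers, and for real $x$ and integers $q\ge1$, $b$ put $$\mathcal A(x)=\sum_{n\le x}a(n),\qquad \mathcal A(x;q,b)=\sum_{\substack{n\le x\\ n\equiv b\ (\mathrm{mod}\ q)}}a(n).$$ Let $\mathcal S$ be a finite set of primes; $(\ell,\mathcal S)=1$ means that $(\ell,p)=1$ for all $p\in\mathcal S$. Let $h$ be a multiplicative function with $0\le h(n)\le 1$ for all $n$, and for $q\ge 1$ put $$\gamma_q=\prod_{p\mid q}\Big(\frac{1-h(p)/p}{1-1/p}\Big)^{-1}.$$ Let $f_q$ be the multiplicative function on the positive integers with $f_q(p^k)=1$ if $p\nmid q$, and, if $p\mid q$ and $p^e$ is the exact power of $p$ dividing $q$, $$f_q(p^k)=\begin{cases}\Big(h(p^k)-\dfrac{h(p^{k+1})}{p}\Big)\Big(1-\dfrac{h(p)}p\Big)^{-1}&\text{if } k<e,\\[2mm] h(p^e)\Big(1-\dfrac1p\Big)\Big(1-\dfrac{h(p)}p\Big)^{-1}&\text{if } k\ge e.\end{cases}$$ Then $f_q(b)=f_q((b,q))$ for $b\ge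 1$; this formula defines $f_q(b)$ for every integer $b$. **Corollary 1.3.** There exist absolute constants $c>0$ and $x_0$ such that the following holds for all real $x\ge x_0$ and all $a(\cdot)$, $\mathcal S$, $h$ as above with $\mathcal S\subset[1,\log\log x]$. Suppose that $$\sum_{p\le\log x}\frac{1-h(p)}{p}\log p\ \ge\ \alpha\log\log x$$ for some $\alpha\ge 60\log\log\log x/\log\log x$, and set $\eta=\min(\alpha/3,1/100)$. Then for each real $u$ with $5/\eta^2\le u\le\eta(\log x)^{\eta/2}$ there exist a real number $y\in(x/4,x)$ and an arithmetic progression $b\pmod\ell$ with $1\le\ell\le x/(\log x)^u$ and $(\ell,\mathcal S)=1$ such that $$\Big|\mathcal A(y;\ell,b)-\frac{f_\ell(b)}{\ell\gamma_\ell}\,y\,\frac{\mathcal A(x)}{x}\Big|\ \ge\ c\,\exp\Big(-\frac u\eta(1+25\eta)\log\frac{2u}{\eta^3}\Big)\frac{\mathcal A(x)}{\phi(\ell)}.$$ -/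

import Mathlib

noncomputable section

/-- `𝒜(x) = ∑_{n ≤ x} a(n)`, the sum running over positive integers `n`. -/
def seqSum (a : ℕ → ℝ) (x : ℝ) : ℝ :=
  ∑ n ∈ Finset.Icc 1 ⌊x⌋₊, a n

/-- `𝒜(x; q, b) = ∑_{n ≤ x, n ≡ b (mod q)} a(n)`, the sum running over positive integers `n`. -/
def seqSumAP (a : ℕ → ℝ) (x : ℝ) (q b : ℕ) : ℝ :=
  ∑ n ∈ Finset.Icc 1 ⌊x⌋₊ with n ≡ b [MOD q], a n

/-- `γ_q = ∏_{p ∣ q} ((1 - h(p)/p) / (1 - 1/p))⁻¹`. -/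
def gammaFactor (h : ArithmeticFunction ℝ) (q : ℕ) : ℝ :=
  ∏ p ∈ q.primeFactors, ((1 - h p / p) / (1 - 1 / (p : ℝ)))⁻¹

/-- The value `f_q(p^k)` when `p` is a prime dividing `q` and `p^e` is the exact power of `p`
dividing `q` (so `e ≥ 1`). -/
def localFactor (h : ArithmeticFunction ℝ) (p e k : ℕ) : ℝ :=
  if k < e then (h (p ^ k) - h (p ^ (k + 1)) / p) * (1 - h p / p)⁻¹
  else h (p ^ e) * (1 - 1 / (p : ℝ)) * (1 - h p / p)⁻¹

/-- The multiplicative function `n ↦ f_q(n)` on positive integers `n`: the product of its values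
`f_q(p^k)` over the exact prime powers `p^k` in `n`. The primes `p ∤ q` contribute `f_q(p^k) = 1`
and are omitted; the primes `p ∣ q` that do not divide `n` contribute `f_q(p^0) = 1`. -/
def fMul (h : ArithmeticFunction ℝ) (q n : ℕ) : ℝ :=
  ∏ p ∈ q.primeFactors, localFactor h p (q.factorization p) (n.factorization p)

/-- `f_q(b) = f_q((b, q))` for an arbitrary residue `b` modulo `q` (including `b = 0`). -/
def fRes (h : ArithmeticFunction ℝ) (q b : ℕ) : ℝ :=
  fMul h q (b.gcd q)

end

/-! The proof is by contradiction, through a Maier matrix with entries `R q + q r + m s`, `r ≤ R`,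
`s ≤ N`. Here `N` is about `(log x) ^ u`, `m` is a prime of size about `x / N`, and `q` is a product
of primes in `((log x) ^ η, (log x) / 4]`. Rows are progressions mod `m`, columns progressions mod
`q`. If both moduli were well distributed, the rows would give total `N R 𝒜(x) / x` up to small
errors, while the columns would give the same quantity weighted by the average of `f_q(s) / γ_q`
over `s ≤ N`. So that average would have to be near 1 (`abs_sieveDev_le_of_wellDistributed`).

It can be kept away from 1 by the choice of `q` (`exists_subset_le_abs_sieveDev`). Split the primes
above `z = (log x) ^ η` into `K ≈ u / η` disjoint blocks. No `n ≤ N ≤ z ^ K` has a prime factor in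
every block, so an alternating sum over unions of blocks vanishes identically, although its expected
main term does not. Hence some union of blocks has a large deviation.

The deviation beats the permitted error by a factor `exp u`, whereas the matrix loses only a
constant times `q / φ(q) ≤ exp (4 / η)`; since `u ≥ 4 / η + 1`, this is a contradiction
(`not_forall_wellDistributed`). -/

/-! ### Large sieve deviations from disjoint blocks of primes. -/

/-- The deviation of `∑_{n ≤ N} ∏_{p ∈ T, p ∣ n} (1 - κ p)` from `N ∏_{p ∈ T} (1 - κ p / p)`. -/
noncomputable def sieveDev (κ : ℕ → ℝ) (N : ℕ) (T : Finset ℕ) : ℝ :=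
  ∑ n ∈ Finset.Icc 1 N, ∏ p ∈ T, (if p ∣ n then 1 - κ p else 1) -
    N * ∏ p ∈ T, (1 - κ p / p)

theorem exists_subset_sum_mem_Icc {ι : Type*} [DecidableEq ι] (w : ι → ℝ) {τ : ℝ} (hτ : 0 < τ)
    (P : Finset ι) (hw : ∀ i ∈ P, w i ≤ τ) (hP : τ ≤ ∑ i ∈ P, w i) :
    ∃ T ⊆ P, τ ≤ ∑ i ∈ T, w i ∧ ∑ i ∈ T, w i ≤ 2 * τ := by
  induction P using Finset.induction_on with
  | empty => simp at hP; linarith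
  | insert a P ha ih =>
    by_cases h : τ ≤ ∑ i ∈ P, w i
    · obtain ⟨T, hT, h1⟩ := ih (fun i hi => hw i (Finset.mem_insert_of_mem hi)) h
      exact ⟨T, hT.trans (Finset.subset_insert a P), h1⟩
    · refine ⟨insert a P, subset_rfl, hP, ?_⟩
      rw [Finset.sum_insert ha]
      have := hw a (Finset.mem_insert_self a P)
      linarith

/-- Greedy extraction: no single weight exceeds `τ`, so a block can be stopped before its weight
passes `2 * τ`, and `K` blocks use at most `2 * K * τ`. -/
theorem exists_disjoint_subsets_sum_ge {ι : Type*} [DecidableEq ι] (w : ι → ℝ) {τ : ℝ}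
    (hτ : 0 < τ) (K : ℕ) (P : Finset ι) (hw : ∀ i ∈ P, w i ≤ τ)
    (hP : 2 * K * τ ≤ ∑ i ∈ P, w i) :
    ∃ A : ℕ → Finset ι, (∀ i < K, A i ⊆ P ∧ τ ≤ ∑ j ∈ A i, w j) ∧
      ∀ i < K, ∀ j < K, i ≠ j → Disjoint (A i) (A j) := by
  induction K generalizing P with
  | zero => exact ⟨fun _ => ∅, by simp, by simp⟩
  | succ K ih =>
    push_cast at hP
    have hK : 0 ≤ 2 * (K : ℝ) * τ := by positivity
    obtain ⟨T, hT, h1, h2⟩ := exists_subset_sum_mem_Icc w hτ P hw (by linarith)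
    have hs := Finset.sum_sdiff (f := w) hT
    obtain ⟨A, hA, hd⟩ := ih (P \ T) (fun i hi => hw i (Finset.sdiff_subset hi)) (by linarith)
    have hAT : ∀ i < K, Disjoint (A i) T := fun i hi =>
      Finset.disjoint_of_subset_left (hA i hi).1 Finset.sdiff_disjoint
    refine ⟨fun i => if i = K then T else A i, fun i hi => ?_, fun i hi j hj hij => ?_⟩
    · by_cases h : i = K
      · simpa [h] using ⟨hT, h1⟩
      · have := hA i (by omega)
        simpa [h] using ⟨this.1.trans Finset.sdiff_subset, this.2⟩
    · by_cases h : i = K <;> by_cases h' : j = K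
      · omega
      · simpa [h, h'] using (hAT j (by omega)).symm
      · simpa [h, h'] using hAT i (by omega)
      · simpa [h, h'] using hd i (by omega) j (by omega) hij

theorem sum_powerset_neg_one_pow_mul_prod {ι : Type*} (s : Finset ι) (X : ι → ℝ) :
    ∑ J ∈ s.powerset, (-1) ^ J.card * ∏ i ∈ J, X i = ∏ i ∈ s, (1 - X i) := by
  simp_rw [sub_eq_add_neg, Finset.prod_one_add, Finset.prod_neg]

theorem prod_one_sub_le_exp_neg_sum {ι : Type*} (s : Finset ι) (w : ι → ℝ)
    (hw : ∀ i ∈ s, w i ≤ 1) : ∏ i ∈ s, (1 - w i) ≤ Real.exp (-∑ i ∈ s, w i) := by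
  rw [← Finset.sum_neg_distrib, Real.exp_sum]
  exact Finset.prod_le_prod (fun i hi => by linarith [hw i hi])
    fun i _ => by linarith [Real.add_one_le_exp (-w i)]

theorem prod_one_sub_le_of_le_sum {ι : Type*} (s : Finset ι) (w : ι → ℝ)
    (hw : ∀ i ∈ s, w i ≤ 1) {τ : ℝ} (h0 : 0 ≤ τ) (h1 : τ ≤ 1) (hτ : τ ≤ ∑ i ∈ s, w i) :
    ∏ i ∈ s, (1 - w i) ≤ 1 - τ / 2 := by
  refine (prod_one_sub_le_exp_neg_sum s w hw).trans ?_
  refine (Real.exp_le_exp.2 (neg_le_neg hτ)).trans ?_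
  rw [Real.exp_neg, inv_le_comm₀ (Real.exp_pos _) (by linarith)]
  refine le_trans ?_ (Real.add_one_le_exp τ)
  rw [inv_le_comm₀ (by linarith) (by linarith), inv_le_iff_one_le_mul₀ (by linarith)]
  nlinarith

/-- Disjointness makes products over unions of blocks multiplicative, so both halves of the
deviation factor over blocks. The half summed over `n` vanishes termwise, leaving only the main
term. -/
theorem sum_neg_one_pow_mul_sieveDev (κ : ℕ → ℝ) {z : ℝ} (hz : 1 ≤ z) {K N : ℕ}
    (hN : (N : ℝ) ≤ z ^ K) (hK : 0 < K) (A : ℕ → Finset ℕ)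
    (hA : ∀ i < K, ∀ p ∈ A i, p.Prime ∧ z < p)
    (hd : ∀ i < K, ∀ j < K, i ≠ j → Disjoint (A i) (A j)) :
    ∑ J ∈ (Finset.range K).powerset, (-1) ^ J.card * sieveDev κ N (J.biUnion A) =
      -(N * ∏ i ∈ Finset.range K, (1 - ∏ p ∈ A i, (1 - κ p / p))) := by
  have hprod : ∀ (f : ℕ → ℝ), ∀ J ∈ (Finset.range K).powerset,
      ∏ p ∈ J.biUnion A, f p = ∏ i ∈ J, ∏ p ∈ A i, f p := by
    intro f J hJ
    rw [Finset.mem_powerset] at hJ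
    refine Finset.prod_biUnion fun i hi j hj hij => ?_
    exact hd i (Finset.mem_range.1 (hJ hi)) j (Finset.mem_range.1 (hJ hj)) hij
  -- A nonzero product would give `n` a prime factor in each of the `K` disjoint blocks, hence `n >
  -- z ^ K ≥ N`.
  have hvanish : ∀ n ∈ Finset.Icc 1 N,
      ∏ i ∈ Finset.range K, (1 - ∏ p ∈ A i, (if p ∣ n then 1 - κ p else 1)) = 0 := by
    intro n hn
    rw [Finset.mem_Icc] at hn
    by_contra hne
    rw [← ne_eq, Finset.prod_ne_zero_iff] at hne
    have hex : ∀ i, ∃ p, i < K → p ∈ A i ∧ p ∣ n := by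
      intro i
      by_cases hi : i < K
      · by_contra! hcon
        refine hne i (Finset.mem_range.2 hi) ?_
        rw [Finset.prod_eq_one, sub_self]
        intro p hp
        rw [if_neg ((hcon p).2 hp)]
      · exact ⟨0, fun h => absurd h hi⟩
    choose g hg using hex
    have hinj : Set.InjOn g (Finset.range K) := by
      intro i hi j hj hij
      by_contra hne'
      rw [Finset.mem_coe, Finset.mem_range] at hi hj
      refine Finset.disjoint_left.1 (hd i hi j hj hne') (hg i hi).1 ?_
      rw [hij]
      exact (hg j hj).1
    have hdvd : ∏ i ∈ Finset.range K, g i ∣ n := by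
      rw [← Finset.prod_image (f := fun p => p) hinj]
      refine Finset.prod_primes_dvd n ?_ ?_ <;>
      · intro p hp
        obtain ⟨i, hi, rfl⟩ := Finset.mem_image.1 hp
        rw [Finset.mem_range] at hi
        first
          | exact (hA i hi _ (hg i hi).1).1.prime
          | exact (hg i hi).2
    have hle : ((∏ i ∈ Finset.range K, g i : ℕ) : ℝ) ≤ z ^ K :=
      le_trans (by exact_mod_cast (Nat.le_of_dvd (by omega) hdvd).trans hn.2) hN
    have hlt : z ^ K < ((∏ i ∈ Finset.range K, g i : ℕ) : ℝ) := by
      push_cast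
      rw [← Finset.card_range K, ← Finset.prod_const, Finset.card_range]
      refine Finset.prod_lt_prod_of_nonempty (fun i _ => by linarith) (fun i hi => ?_) (by simpa using hK.ne')
      exact (hA i (Finset.mem_range.1 hi) _ (hg i (Finset.mem_range.1 hi)).1).2
    linarith
  simp only [sieveDev, mul_sub, Finset.sum_sub_distrib]
  have h1 : ∑ J ∈ (Finset.range K).powerset, (-1 : ℝ) ^ J.card *
      ∑ n ∈ Finset.Icc 1 N, ∏ p ∈ J.biUnion A, (if p ∣ n then 1 - κ p else 1) = 0 := by
    simp_rw [Finset.mul_sum]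
    rw [Finset.sum_comm]
    refine Finset.sum_eq_zero fun n hn => ?_
    rw [← hvanish n hn, ← sum_powerset_neg_one_pow_mul_prod]
    exact Finset.sum_congr rfl fun J hJ => by rw [hprod _ J hJ]
  rw [h1, zero_sub, ← sum_powerset_neg_one_pow_mul_prod, Finset.mul_sum]
  congr 1
  exact Finset.sum_congr rfl fun J hJ => by rw [hprod _ J hJ]; ring

/-- With blocks of weight at least `τ = m / (2K)`, each factor of the main term is at least `τ / 2`.
Pigeonholing over the `2 ^ K` unions halves the base once more, to `m / (8K)`. -/
theorem exists_subset_le_abs_sieveDev (κ : ℕ → ℝ) (hκ1 : ∀ p, κ p ≤ 1)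
    (P : Finset ℕ) {z : ℝ} (hP : ∀ p ∈ P, p.Prime ∧ z < p) (hz : 1 ≤ z) {K N : ℕ} (hK : 0 < K)
    (hN : (N : ℝ) ≤ z ^ K) {m : ℝ} (hm0 : 0 < m) (hm1 : m ≤ 1) (hm : m ≤ ∑ p ∈ P, κ p / p)
    (hzm : 2 * K / m ≤ z) :
    ∃ T ⊆ P, N * (m / (8 * K)) ^ K ≤ |sieveDev κ N T| := by
  have hK1 : (1 : ℝ) ≤ K := by exact_mod_cast hK
  have hK0 : (0 : ℝ) < K := by linarith
  set τ : ℝ := m / (2 * K) with hτ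
  have hτ0 : 0 < τ := by positivity
  have hτ1 : τ ≤ 1 := by rw [hτ, div_le_one (by positivity)]; linarith
  have hw : ∀ p ∈ P, κ p / p ≤ 1 / z := fun p hp => by
    have := hP p hp
    exact div_le_div₀ zero_le_one (hκ1 p) (by linarith) this.2.le
  have hzτ : 1 / z ≤ τ := by
    rw [hτ, div_le_div_iff₀ (by linarith) (by positivity)]
    rw [div_le_iff₀ hm0] at hzm
    linarith
  obtain ⟨A, hA, hd⟩ := exists_disjoint_subsets_sum_ge (fun p : ℕ => κ p / p) hτ0 K P
    (fun p hp => (hw p hp).trans hzτ) (by rw [hτ]; field_simp at hm ⊢; linarith)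
  have hid := sum_neg_one_pow_mul_sieveDev κ hz hN hK A
    (fun i hi p hp => hP p ((hA i hi).1 hp)) hd
  have hlow : (τ / 2) ^ K ≤ ∏ i ∈ Finset.range K, (1 - ∏ p ∈ A i, (1 - κ p / p)) := by
    rw [← Finset.card_range K, ← Finset.prod_const, Finset.card_range]
    refine Finset.prod_le_prod (fun i _ => by positivity) fun i hi => ?_
    have hi := hA i (Finset.mem_range.1 hi)
    have := prod_one_sub_le_of_le_sum (A i) (fun p : ℕ => κ p / p)
      (fun p hp => (hw p (hi.1 hp)).trans (hzτ.trans hτ1)) hτ0.le hτ1 hi.2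
    linarith
  have hsum : (N : ℝ) * (τ / 2) ^ K ≤
      ∑ J ∈ (Finset.range K).powerset, |sieveDev κ N (J.biUnion A)| := by
    calc (N : ℝ) * (τ / 2) ^ K
        ≤ N * ∏ i ∈ Finset.range K, (1 - ∏ p ∈ A i, (1 - κ p / p)) := by gcongr
      _ ≤ |∑ J ∈ (Finset.range K).powerset, (-1) ^ J.card * sieveDev κ N (J.biUnion A)| := by
          rw [hid, abs_neg]; exact le_abs_self _
      _ ≤ ∑ J ∈ (Finset.range K).powerset, |(-1) ^ J.card * sieveDev κ N (J.biUnion A)| :=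
          Finset.abs_sum_le_sum_abs _ _
      _ = _ := by simp [abs_mul]
  have hconst : (N : ℝ) * (τ / 2) ^ K =
      ∑ _J ∈ (Finset.range K).powerset, N * (m / (8 * K)) ^ K := by
    rw [Finset.sum_const, Finset.card_powerset, Finset.card_range, nsmul_eq_mul,
      show m / (8 * K) = τ / 2 / 2 by rw [hτ]; field_simp; norm_num, div_pow (τ / 2)]
    push_cast
    field_simp
  rw [hconst] at hsum
  obtain ⟨J, hJ, hle⟩ := Finset.exists_le_of_sum_le ⟨∅, Finset.empty_mem_powerset _⟩ hsum
  refine ⟨J.biUnion A, ?_, hle⟩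
  refine Finset.biUnion_subset.2 fun i hi => ?_
  exact (hA i (Finset.mem_range.1 (Finset.mem_powerset.1 hJ hi))).1

/-! ### Local densities at squarefree moduli. -/

/-- The weight `κ_p` with `f_q(p) = 1 - κ_p` and local density `γ_p = 1 - κ_p / p`. -/
noncomputable def sieveWeight (h : ArithmeticFunction ℝ) (p : ℕ) : ℝ := (1 - h p) / (1 - h p / p)

theorem one_sub_div_pos {h : ArithmeticFunction ℝ} (hh : ∀ n, 0 ≤ h n ∧ h n ≤ 1) {p : ℕ}
    (hp : p.Prime) : 0 < 1 - h p / p := by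
  have h2 : (2 : ℝ) ≤ p := by exact_mod_cast hp.two_le
  rw [sub_pos, div_lt_one (by linarith)]
  linarith [(hh p).2]

theorem one_sub_le_sieveWeight {h : ArithmeticFunction ℝ} (hh : ∀ n, 0 ≤ h n ∧ h n ≤ 1) {p : ℕ}
    (hp : p.Prime) : 1 - h p ≤ sieveWeight h p := by
  have h1 := one_sub_div_pos hh hp
  rw [sieveWeight, le_div_iff₀ h1]
  have := div_nonneg (hh p).1 (Nat.cast_nonneg p)
  nlinarith [(hh p).2]

theorem sieveWeight_le_one {h : ArithmeticFunction ℝ} (hh : ∀ n, 0 ≤ h n ∧ h n ≤ 1) (p : ℕ) :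
    sieveWeight h p ≤ 1 := by
  rcases Nat.eq_zero_or_pos p with rfl | hp
  · simp [sieveWeight]
  have h1 : (1 : ℝ) ≤ p := by exact_mod_cast hp
  have h2 : h p / p ≤ h p := div_le_self (hh p).1 h1
  exact div_le_one_of_le₀ (by linarith) (by linarith [(hh p).2])

theorem inv_density_eq {h : ArithmeticFunction ℝ} (hh : ∀ n, 0 ≤ h n ∧ h n ≤ 1) {p : ℕ}
    (hp : p.Prime) : ((1 - h p / p) / (1 - 1 / (p : ℝ)))⁻¹ = 1 - sieveWeight h p / p := by
  have h1 := (one_sub_div_pos hh hp).ne'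
  have h0 : (p : ℝ) ≠ 0 := by exact_mod_cast hp.ne_zero
  rw [sieveWeight, inv_div, eq_sub_iff_add_eq, div_div, div_add_div _ _ h1 (mul_ne_zero h1 h0),
    div_eq_one_iff_eq (by positivity)]
  field_simp
  ring

theorem gammaFactor_eq_prod {h : ArithmeticFunction ℝ} (hh : ∀ n, 0 ≤ h n ∧ h n ≤ 1) (q : ℕ) :
    gammaFactor h q = ∏ p ∈ q.primeFactors, (1 - sieveWeight h p / p) := by
  rw [gammaFactor]
  exact Finset.prod_congr rfl fun _ hp => inv_density_eq hh (Nat.prime_of_mem_primeFactors hp)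

/-- For squarefree `q` every exponent is `e = 1`, so only divisibility of `b` by `p` matters. The
resulting sieve weight has mean `γ_q`, so `sieveDev` is the error in averaging `f_q`. -/
theorem fRes_eq_prod {h : ArithmeticFunction ℝ} (hh : ∀ n, 0 ≤ h n ∧ h n ≤ 1)
    (h1 : h.IsMultiplicative) {q : ℕ} (hq : Squarefree q) (b : ℕ) :
    fRes h q b = ∏ p ∈ q.primeFactors, (if p ∣ b then 1 - sieveWeight h p else 1) := by
  rw [fRes, fMul]
  refine Finset.prod_congr rfl fun p hp => ?_
  have hpp := Nat.prime_of_mem_primeFactors hp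
  have hpq := Nat.dvd_of_mem_primeFactors hp
  have hpos := (one_sub_div_pos hh hpp).ne'
  have h0 : (p : ℝ) ≠ 0 := by exact_mod_cast hpp.ne_zero
  have hfac : q.factorization p = 1 :=
    le_antisymm (hq.natFactorization_le_one p)
      ((hpp.dvd_iff_one_le_factorization hq.ne_zero).1 hpq)
  by_cases hb : p ∣ b
  · have hg : 1 ≤ (b.gcd q).factorization p :=
      (hpp.dvd_iff_one_le_factorization (Nat.gcd_pos_of_pos_right _ hq.ne_zero.bot_lt).ne').1
        (Nat.dvd_gcd hb hpq)
    rw [if_pos hb, localFactor, hfac, if_neg (by omega), pow_one, sieveWeight, ← div_eq_mul_inv,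
      eq_sub_iff_add_eq, ← add_div, div_eq_one_iff_eq hpos]
    field_simp
    ring
  · have hg : (b.gcd q).factorization p = 0 :=
      Nat.factorization_eq_zero_of_not_dvd fun hd => hb (hd.trans (Nat.gcd_dvd_left b q))
    rw [if_neg hb, localFactor, hfac, hg, if_pos one_pos, pow_zero, zero_add, pow_one, h1.1,
      mul_inv_cancel₀ hpos]

theorem gammaFactor_pos {h : ArithmeticFunction ℝ} (hh : ∀ n, 0 ≤ h n ∧ h n ≤ 1) (q : ℕ) :
    0 < gammaFactor h q := by
  refine Finset.prod_pos fun p hp => inv_pos.2 (div_pos ?_ ?_)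
  · exact one_sub_div_pos hh (Nat.prime_of_mem_primeFactors hp)
  · have h2 : (1 : ℝ) < p := by exact_mod_cast (Nat.prime_of_mem_primeFactors hp).one_lt
    rw [sub_pos, div_lt_one (by linarith)]
    exact h2

theorem gammaFactor_le_one {h : ArithmeticFunction ℝ} (hh : ∀ n, 0 ≤ h n ∧ h n ≤ 1) (q : ℕ) :
    gammaFactor h q ≤ 1 := by
  rw [gammaFactor_eq_prod hh]
  refine Finset.prod_le_one (fun p hp => ?_) fun p hp => ?_
  · have h2 : (1 : ℝ) < p := by exact_mod_cast (Nat.prime_of_mem_primeFactors hp).one_lt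
    rw [sub_nonneg, div_le_one (by linarith)]
    linarith [sieveWeight_le_one hh p]
  · rw [sub_le_self_iff]
    refine div_nonneg ?_ (Nat.cast_nonneg p)
    linarith [one_sub_le_sieveWeight hh (Nat.prime_of_mem_primeFactors hp), (hh p).2]

/-! ### The Maier matrix. -/

theorem sum_Icc_arith_prog (a : ℕ → ℝ) {m : ℕ} (hm : 0 < m) (b M : ℕ) :
    ∑ s ∈ Finset.Icc 1 M, a (b + m * s) =
      seqSumAP a ((b + m * M : ℕ) : ℝ) m b - seqSumAP a (b : ℝ) m b := by
  rw [eq_sub_iff_add_eq, seqSumAP, seqSumAP, Nat.floor_natCast, Nat.floor_natCast]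
  have hinj : Set.InjOn (fun s => b + m * s) (Finset.Icc 1 M : Set ℕ) := fun s _ t _ hst =>
    Nat.eq_of_mul_eq_mul_left hm (Nat.add_left_cancel hst)
  rw [← Finset.sum_image (f := a) hinj, ← Finset.sum_union]
  · congr 1
    ext n
    simp only [Finset.mem_union, Finset.mem_image, Finset.mem_filter, Finset.mem_Icc]
    constructor
    · rintro (⟨s, ⟨hs1, hs2⟩, rfl⟩ | ⟨⟨hn1, hn2⟩, hn⟩)
      · refine ⟨⟨?_, by gcongr⟩, by simp [Nat.ModEq]⟩
        have := Nat.mul_pos hm hs1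
        omega
      · exact ⟨⟨hn1, hn2.trans (Nat.le_add_right _ _)⟩, hn⟩
    · rintro ⟨⟨hn1, hn2⟩, hn⟩
      rcases le_or_gt n b with hb | hb
      · exact Or.inr ⟨⟨hn1, hb⟩, hn⟩
      · left
        obtain ⟨s, hs⟩ := (Nat.modEq_iff_dvd' hb.le).1 hn.symm
        have hs' : n = b + m * s := by omega
        refine ⟨s, ⟨Nat.pos_of_ne_zero ?_, ?_⟩, hs'.symm⟩
        · rintro rfl
          simp at hs'
          omega
        · exact Nat.le_of_mul_le_mul_left (by omega) hm
  · rw [Finset.disjoint_left]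
    intro n hn hn'
    obtain ⟨s, hs, rfl⟩ := Finset.mem_image.1 hn
    have h1 := (Finset.mem_Icc.1 (Finset.mem_filter.1 hn').1).2
    have := Nat.mul_pos hm (Finset.mem_Icc.1 hs).1
    omega

/-- The expected size of the sum over a progression, with discrepancy at most `D`. -/
def WellDistributed (a : ℕ → ℝ) (h : ArithmeticFunction ℝ) (x : ℝ) (l : ℕ) (D : ℝ) : Prop :=
  ∀ (y : ℝ) (b : ℕ), x / 4 < y → y < x →
    |seqSumAP a y l b - fRes h l b / ((l : ℝ) * gammaFactor h l) * (y * (seqSum a x / x))| ≤ D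

theorem WellDistributed.abs_sum_sub_le {a : ℕ → ℝ} {h : ArithmeticFunction ℝ} {x D : ℝ} {l : ℕ}
    (hl : 0 < l) (hD : WellDistributed a h x l D) (b M : ℕ) (h1 : x / 4 < b)
    (h2 : ((b + l * M : ℕ) : ℝ) < x) :
    |∑ s ∈ Finset.Icc 1 M, a (b + l * s) -
      M * (seqSum a x / x) * (fRes h l b / gammaFactor h l)| ≤ 2 * D := by
  have hl' : (0 : ℝ) < l := by exact_mod_cast hl
  have hle : (b : ℝ) ≤ ((b + l * M : ℕ) : ℝ) := by exact_mod_cast Nat.le_add_right _ _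
  have e1 := hD _ b (h1.trans_le hle) h2
  have e2 := hD _ b h1 (hle.trans_lt h2)
  rw [sum_Icc_arith_prog a hl]
  have hmain : (M : ℝ) * (seqSum a x / x) * (fRes h l b / gammaFactor h l) =
      fRes h l b / ((l : ℝ) * gammaFactor h l) * (((b + l * M : ℕ) : ℝ) * (seqSum a x / x)) -
        fRes h l b / ((l : ℝ) * gammaFactor h l) * ((b : ℝ) * (seqSum a x / x)) := by
    push_cast
    rw [← mul_sub, ← sub_mul, add_sub_cancel_left, ← div_div, div_right_comm]
    field_simp
  rw [abs_le] at e1 e2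
  rw [hmain, abs_le]
  constructor <;> linarith [e1.1, e1.2, e2.1, e2.2]

/-- Double counting of the matrix. The offset `R * q` keeps both endpoints of every row and column
in `(x / 4, x)`, where the distribution hypotheses apply. -/
theorem abs_row_sub_column_le {a : ℕ → ℝ} {h : ArithmeticFunction ℝ} {x Dl Dq : ℝ} {l q R N : ℕ}
    (hl : 0 < l) (hq : 0 < q) (hDl : WellDistributed a h x l Dl) (hDq : WellDistributed a h x q Dq)
    (h1 : x / 4 < (R * q : ℕ)) (h2 : ((2 * (R * q) + l * N : ℕ) : ℝ) < x) :
    |N * (seqSum a x / x) * ∑ r ∈ Finset.Icc 1 R, fRes h l (R * q + q * r) / gammaFactor h l -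
      R * (seqSum a x / x) * ∑ s ∈ Finset.Icc 1 N, fRes h q (R * q + l * s) / gammaFactor h q| ≤
      R * (2 * Dl) + N * (2 * Dq) := by
  have hrow : ∀ r ∈ Finset.Icc 1 R, |∑ s ∈ Finset.Icc 1 N, a (R * q + q * r + l * s) -
      N * (seqSum a x / x) * (fRes h l (R * q + q * r) / gammaFactor h l)| ≤ 2 * Dl := by
    intro r hr
    have hr2 := (Finset.mem_Icc.1 hr).2
    have hqr : q * r ≤ R * q := by rw [mul_comm R]; gcongr
    refine hDl.abs_sum_sub_le hl _ N (h1.trans_le ?_) (lt_of_le_of_lt ?_ h2)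
    · exact_mod_cast Nat.le_add_right _ _
    · exact_mod_cast (by omega)
  have hcol : ∀ s ∈ Finset.Icc 1 N, |∑ r ∈ Finset.Icc 1 R, a (R * q + l * s + q * r) -
      R * (seqSum a x / x) * (fRes h q (R * q + l * s) / gammaFactor h q)| ≤ 2 * Dq := by
    intro s hs
    have hs2 := (Finset.mem_Icc.1 hs).2
    have hls : l * s ≤ l * N := by gcongr
    have hqr : q * R = R * q := mul_comm _ _
    refine hDq.abs_sum_sub_le hq _ R (h1.trans_le ?_) (lt_of_le_of_lt ?_ h2)
    · exact_mod_cast Nat.le_add_right _ _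
    · exact_mod_cast (by omega)
  have hR := (Finset.abs_sum_le_sum_abs _ _).trans (Finset.sum_le_sum hrow)
  have hC := (Finset.abs_sum_le_sum_abs _ _).trans (Finset.sum_le_sum hcol)
  have hswap : ∑ s ∈ Finset.Icc 1 N, ∑ r ∈ Finset.Icc 1 R, a (R * q + l * s + q * r) =
      ∑ r ∈ Finset.Icc 1 R, ∑ s ∈ Finset.Icc 1 N, a (R * q + q * r + l * s) := by
    rw [Finset.sum_comm]
    exact Finset.sum_congr rfl fun r _ => Finset.sum_congr rfl fun s _ => by rw [add_right_comm]
  rw [Finset.sum_sub_distrib, ← Finset.mul_sum, Finset.sum_const, Nat.card_Icc, nsmul_eq_mul,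
    Nat.add_sub_cancel] at hR hC
  rw [hswap] at hC
  rw [abs_le] at *
  constructor <;> linarith [hR.1, hR.2, hC.1, hC.2]

/-- For prime `l` the normalized density is within `2 / l` of 1 unless `l ∣ R + r`. In that case it
is `h l`, off by at most 1, and this happens for at most `2 * R / l` rows. -/
theorem abs_sum_row_sub_le {h : ArithmeticFunction ℝ} (hh : ∀ n, 0 ≤ h n ∧ h n ≤ 1)
    (h1 : h.IsMultiplicative) {l q : ℕ} (hl : l.Prime) (hlq : l.Coprime q) (R : ℕ) :
    |∑ r ∈ Finset.Icc 1 R, fRes h l (R * q + q * r) / gammaFactor h l - R| ≤ 4 * R / l := by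
  have h2 : (2 : ℝ) ≤ l := by exact_mod_cast hl.two_le
  have hl1 : 0 < 1 - 1 / (l : ℝ) := by
    rw [sub_pos, div_lt_one (by linarith)]; linarith
  have hγ : gammaFactor h l = 1 - sieveWeight h l / l := by
    rw [gammaFactor_eq_prod hh, hl.primeFactors, Finset.prod_singleton]
  have hγ' : gammaFactor h l = (1 - 1 / (l : ℝ)) / (1 - h l / l) := by
    rw [hγ, ← inv_density_eq hh hl, inv_div]
  have hpos := one_sub_div_pos hh hl
  have hterm : ∀ r ∈ Finset.Icc 1 R, |fRes h l (R * q + q * r) / gammaFactor h l - 1| ≤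
      2 / l + if l ∣ R + r then 1 else 0 := by
    intro r _
    have hdvd : l ∣ R * q + q * r ↔ l ∣ R + r := by
      rw [mul_comm R q, ← mul_add, hlq.dvd_mul_left]
    rw [fRes_eq_prod hh h1 hl.prime.squarefree, hl.primeFactors, Finset.prod_singleton, hγ']
    simp only [hdvd]
    split_ifs with hd
    · have : (1 - sieveWeight h l) / ((1 - 1 / (l : ℝ)) / (1 - h l / l)) = h l := by
        rw [sieveWeight, one_sub_div hpos.ne', div_div_div_cancel_right₀ hpos.ne', div_eq_iff hl1.ne']
        ring
      rw [this, abs_le]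
      have : (0 : ℝ) ≤ 2 / l := by positivity
      constructor <;> linarith [(hh l).1, (hh l).2]
    · have : 1 / ((1 - 1 / (l : ℝ)) / (1 - h l / l)) - 1 = (1 - h l) / (l - 1) := by
        have : (l : ℝ) - 1 ≠ 0 := by linarith
        have : (l : ℝ) ≠ 0 := by linarith
        rw [one_div_div, sub_eq_iff_eq_add]
        field_simp
        ring
      rw [this, add_zero, abs_of_nonneg (div_nonneg (by linarith [(hh l).2]) (by linarith)),
        div_le_div_iff₀ (by linarith) (by linarith)]
      nlinarith [(hh l).1, (hh l).2]
  have hcount : ∑ r ∈ Finset.Icc 1 R, (if l ∣ R + r then (1 : ℝ) else 0) ≤ 2 * R / l := by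
    rw [Finset.sum_boole]
    have hc : ((Finset.Icc 1 R).filter fun r => l ∣ R + r).card ≤ (2 * R) / l := by
      rw [← Nat.Ioc_filter_dvd_card_eq_div]
      refine Finset.card_le_card_of_injOn (fun r => R + r) ?_ (fun a _ b _ h => Nat.add_left_cancel h)
      intro r hr
      simp only [Finset.coe_filter, Finset.mem_Icc, Set.mem_ofPred_eq, Finset.mem_Ioc] at hr ⊢
      exact ⟨by omega, hr.2⟩
    calc _ ≤ (((2 * R) / l : ℕ) : ℝ) := by exact_mod_cast hc
      _ ≤ _ := by simpa using Nat.cast_div_le (α := ℝ) (m := 2 * R) (n := l)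
  have hsum := (Finset.abs_sum_le_sum_abs _ _).trans (Finset.sum_le_sum hterm)
  rw [Finset.sum_sub_distrib, Finset.sum_add_distrib] at hsum
  simp only [Finset.sum_const, Nat.card_Icc, nsmul_eq_mul, Nat.add_sub_cancel, mul_one] at hsum
  refine hsum.trans ?_
  calc (R : ℝ) * (2 / l) + _ ≤ R * (2 / l) + 2 * R / l := by gcongr
    _ = _ := by ring

/-- As `l` is invertible modulo each `p ∈ T`, column `s` is divisible by `p` exactly when `s` is.
Dividing by `γ_q ≤ 1` can only enlarge the deviation. -/
theorem le_abs_sum_column_sub {h : ArithmeticFunction ℝ} (hh : ∀ n, 0 ≤ h n ∧ h n ≤ 1)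
    (h1 : h.IsMultiplicative) {T : Finset ℕ} (hT : ∀ p ∈ T, p.Prime) {l : ℕ}
    (hl : ∀ p ∈ T, l.Coprime p) (R N : ℕ) :
    |sieveDev (sieveWeight h) N T| ≤
      |∑ s ∈ Finset.Icc 1 N, fRes h (∏ p ∈ T, p) (R * (∏ p ∈ T, p) + l * s) /
        gammaFactor h (∏ p ∈ T, p) - N| := by
  have hsq : Squarefree (∏ p ∈ T, p) := by
    refine Finset.squarefree_prod_of_pairwise_isCoprime ?_ fun p hp => (hT p hp).prime.squarefree
    intro p hp r hr hpr
    exact Nat.coprime_iff_isRelPrime.1 ((Nat.coprime_primes (hT p hp) (hT r hr)).2 hpr)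
  have hpf := Nat.primeFactors_prod hT
  have hγ0 := gammaFactor_pos hh (∏ p ∈ T, p)
  have hγ1 := gammaFactor_le_one hh (∏ p ∈ T, p)
  have hγ := gammaFactor_eq_prod hh (∏ p ∈ T, p)
  rw [hpf] at hγ
  have hf : ∀ s ∈ Finset.Icc 1 N, fRes h (∏ p ∈ T, p) (R * (∏ p ∈ T, p) + l * s) =
      ∏ p ∈ T, (if p ∣ s then 1 - sieveWeight h p else 1) := by
    intro s _
    rw [fRes_eq_prod hh h1 hsq, hpf]
    refine Finset.prod_congr rfl fun p hp => ?_
    have : p ∣ R * (∏ p ∈ T, p) + l * s ↔ p ∣ s := by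
      rw [Nat.dvd_add_right (Dvd.dvd.mul_left (Finset.dvd_prod_of_mem (fun p => p) hp) _),
        (hl p hp).symm.dvd_mul_left]
    simp only [this]
  rw [← Finset.sum_div, Finset.sum_congr rfl hf]
  have : sieveDev (sieveWeight h) N T = gammaFactor h (∏ p ∈ T, p) *
      ((∑ s ∈ Finset.Icc 1 N, ∏ p ∈ T, (if p ∣ s then 1 - sieveWeight h p else 1)) /
        gammaFactor h (∏ p ∈ T, p) - N) := by
    rw [sieveDev, ← hγ]
    field_simp
  rw [this, abs_mul, abs_of_pos hγ0]
  exact mul_le_of_le_one_left (abs_nonneg _) hγ1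

/-- The Maier matrix inequality: if both progressions are well distributed then the sieve
deviation is small. -/
theorem abs_sieveDev_le_of_wellDistributed {a : ℕ → ℝ} {h : ArithmeticFunction ℝ}
    (hh : ∀ n, 0 ≤ h n ∧ h n ≤ 1) (h1 : h.IsMultiplicative) {T : Finset ℕ}
    (hT : ∀ p ∈ T, p.Prime) {l R N : ℕ} (hl : l.Prime) (hlT : ∀ p ∈ T, l.Coprime p) {x G : ℝ}
    (hx : 0 < x) (hA : 0 < seqSum a x) (hN : 0 < N) (hR : 0 < R)
    (hDl : WellDistributed a h x l (G * (seqSum a x / l.totient)))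
    (hDq : WellDistributed a h x (∏ p ∈ T, p) (G * (seqSum a x / (∏ p ∈ T, p).totient)))
    (hx1 : x / 4 < (R * ∏ p ∈ T, p : ℕ)) (hx2 : ((2 * (R * ∏ p ∈ T, p) + l * N : ℕ) : ℝ) < x) :
    |sieveDev (sieveWeight h) N T| / N ≤
      4 / l + 2 * G * (x / (N * l.totient) + x / (R * (∏ p ∈ T, p).totient)) := by
  have hq : 0 < ∏ p ∈ T, p := Finset.prod_pos fun p hp => (hT p hp).pos
  have hmat := abs_row_sub_column_le hl.pos hq hDl hDq hx1 hx2
  have hrow := abs_sum_row_sub_le hh h1 hl (Nat.Coprime.prod_right hlT) R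
  have hcol := le_abs_sum_column_sub hh h1 hT hlT R N
  generalize (∏ p ∈ T, p) = q at *
  generalize ∑ r ∈ Finset.Icc 1 R, fRes h l (R * q + q * r) / gammaFactor h l = ρ at *
  generalize ∑ s ∈ Finset.Icc 1 N, fRes h q (R * q + l * s) / gammaFactor h q = σ at *
  refine (div_le_div_of_nonneg_right hcol (Nat.cast_nonneg N)).trans ?_
  generalize seqSum a x = A at *
  have hN' : (0 : ℝ) < N := by exact_mod_cast hN
  have hR' : (0 : ℝ) < R := by exact_mod_cast hR
  have hl' : (0 : ℝ) < l := by exact_mod_cast hl.pos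
  have hφl : (0 : ℝ) < l.totient := by exact_mod_cast Nat.totient_pos.2 hl.pos
  have hφq : (0 : ℝ) < q.totient := by exact_mod_cast Nat.totient_pos.2 hq
  -- Both main terms equal `N R A / x`, so the column error is the row error minus the matrix
  -- discrepancy.
  have hdecomp : R * (A / x) * (σ - N) =
      N * (A / x) * (ρ - R) - (N * (A / x) * ρ - R * (A / x) * σ) := by ring
  have hAx : 0 < A / x := by positivity
  have hbound : R * (A / x) * |σ - N| ≤ N * (A / x) * (4 * R / l) +
      (R * (2 * (G * (A / l.totient))) + N * (2 * (G * (A / q.totient)))) := by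
    calc R * (A / x) * |σ - N| = |R * (A / x) * (σ - N)| := by
          rw [abs_mul (R * (A / x)), abs_of_pos (by positivity : 0 < R * (A / x))]
      _ ≤ |N * (A / x) * (ρ - R)| + |N * (A / x) * ρ - R * (A / x) * σ| := by
          rw [hdecomp]; exact abs_sub _ _
      _ ≤ _ := by
          refine add_le_add ?_ hmat
          rw [abs_mul (N * (A / x)), abs_of_pos (by positivity : 0 < N * (A / x))]
          gcongr
  rw [div_le_iff₀ hN']
  have hfac : 0 < R * (A / x) := by positivity
  refine le_of_mul_le_mul_left (hbound.trans (le_of_eq ?_)) hfac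
  field_simp

/-! ### Chebyshev and Mertens bounds for the sieving primes. -/

theorem sum_log_primes_le {y : ℝ} (hy : 0 ≤ y) :
    ∑ p ∈ Finset.Icc 1 ⌊y⌋₊ with p.Prime, Real.log p ≤ Real.log 4 * y := by
  refine le_trans (le_of_eq ?_) (Chebyshev.theta_le_log4_mul_x hy)
  rfl

/-- The primes dividing `k` have product at most `k`; summing their logarithms over `k ≤ n` bounds
the sum with `⌊n / p⌋`. Removing the floors costs a Chebyshev sum. -/
theorem sum_log_div_primes_le {n : ℕ} (hn : 0 < n) :
    ∑ p ∈ Finset.Icc 1 n with p.Prime, Real.log p / p ≤ Real.log n + Real.log 4 := by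
  have hn' : (0 : ℝ) < n := by exact_mod_cast hn
  have hθ := sum_log_primes_le hn'.le
  rw [Nat.floor_natCast] at hθ
  have hfloor : ∑ p ∈ Finset.Icc 1 n with p.Prime, Real.log p * ((n / p : ℕ) : ℝ) ≤
      n * Real.log n := by
    calc ∑ p ∈ Finset.Icc 1 n with p.Prime, Real.log p * ((n / p : ℕ) : ℝ)
        = ∑ p ∈ Finset.Icc 1 n with p.Prime, ∑ k ∈ Finset.Ioc 0 n,
            if p ∣ k then Real.log p else 0 := by
          refine Finset.sum_congr rfl fun p _ => ?_
          rw [← Finset.sum_filter, Finset.sum_const, Nat.Ioc_filter_dvd_card_eq_div,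
            nsmul_eq_mul, mul_comm]
      _ = ∑ k ∈ Finset.Ioc 0 n, ∑ p ∈ Finset.Icc 1 n with p.Prime,
            if p ∣ k then Real.log p else 0 := Finset.sum_comm
      _ ≤ ∑ k ∈ Finset.Ioc 0 n, Real.log n := by
          refine Finset.sum_le_sum fun k hk => ?_
          obtain ⟨hk0, hkn⟩ := Finset.mem_Ioc.1 hk
          have hprime : ∀ p ∈ (Finset.Icc 1 n).filter Nat.Prime |>.filter (· ∣ k),
              p.Prime ∧ p ∣ k := fun p hp => by
            rw [Finset.mem_filter, Finset.mem_filter] at hp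
            exact ⟨hp.1.2, hp.2⟩
          have hdvd : ∏ p ∈ (Finset.Icc 1 n).filter Nat.Prime |>.filter (· ∣ k), p ∣ k :=
            Finset.prod_primes_dvd k (fun p hp => (hprime p hp).1.prime)
              fun p hp => (hprime p hp).2
          rw [← Finset.sum_filter, ← Real.log_prod
            (fun p hp => by exact_mod_cast (hprime p hp).1.ne_zero)]
          refine Real.log_le_log ?_ ?_
          · exact Finset.prod_pos fun p hp => by exact_mod_cast (hprime p hp).1.pos
          · rw [← Nat.cast_prod]
            exact_mod_cast (Nat.le_of_dvd hk0 hdvd).trans hkn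
      _ = n * Real.log n := by simp
  have hterm : ∀ p ∈ (Finset.Icc 1 n).filter Nat.Prime, n * (Real.log p / p) ≤
      Real.log p * ((n / p : ℕ) : ℝ) + Real.log p := by
    intro p hp
    have hpp := (Finset.mem_filter.1 hp).2
    have hp0 : (0 : ℝ) < p := by exact_mod_cast hpp.pos
    have hlog : 0 ≤ Real.log p := Real.log_natCast_nonneg p
    have hlt : (n : ℝ) / p < ((n / p : ℕ) : ℝ) + 1 := by
      rw [← Nat.floor_div_eq_div (K := ℝ)]
      exact Nat.lt_floor_add_one _
    calc n * (Real.log p / p) = Real.log p * (n / p) := by ring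
      _ ≤ Real.log p * (((n / p : ℕ) : ℝ) + 1) := by gcongr
      _ = _ := by ring
  have hsum := Finset.sum_le_sum hterm
  rw [← Finset.mul_sum, Finset.sum_add_distrib] at hsum
  refine le_of_mul_le_mul_left ?_ hn'
  linarith

theorem log_four_lt : Real.log 4 < 1.4 := by
  rw [show (4 : ℝ) = 2 ^ 2 by norm_num, Real.log_pow]
  push_cast
  linarith [Real.log_two_lt_d9]

/-- The primes in `(exp (η log L), L / 4]`. -/
noncomputable def sievePrimes (L η : ℝ) : Finset ℕ :=
  ((Finset.Icc 1 ⌊L⌋₊).filter Nat.Prime).filter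
    fun p => Real.exp (η * Real.log L) < p ∧ (p : ℝ) ≤ L / 4

theorem mem_sievePrimes {L η : ℝ} {p : ℕ} (hp : p ∈ sievePrimes L η) :
    p.Prime ∧ Real.exp (η * Real.log L) < p ∧ (p : ℝ) ≤ L / 4 := by
  rw [sievePrimes, Finset.mem_filter, Finset.mem_filter] at hp
  exact ⟨hp.1.2, hp.2⟩

/-- Out of at least `3 η log L`, primes up to `L ^ η` take at most `η log L + log 4` and primes
above `L / 4` at most `4 log 4`. The rest exceeds `η log L`, because `5 log 4 < 7 < 20 ≤ η log L`.
-/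
theorem le_sum_sieveWeight_div {h : ArithmeticFunction ℝ} (hh : ∀ n, 0 ≤ h n ∧ h n ≤ 1)
    {L α η : ℝ} (hL : 1 < L) (hη : 0 < η) (hηα : 3 * η ≤ α) (hηL : 20 ≤ η * Real.log L)
    (hα : α * Real.log L ≤ ∑ p ∈ Finset.Icc 1 ⌊L⌋₊ with p.Prime,
      (1 - h p) / (p : ℝ) * Real.log (p : ℝ)) :
    η ≤ ∑ p ∈ sievePrimes L η, sieveWeight h p / p := by
  have hlogL : 0 < Real.log L := Real.log_pos hL
  set z := Real.exp (η * Real.log L) with hz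
  have hz1 : 1 ≤ z := Real.one_le_exp (by positivity)
  have hzf : 0 < ⌊z⌋₊ := Nat.floor_pos.2 hz1
  have hterm : ∀ p ∈ (Finset.Icc 1 ⌊L⌋₊).filter Nat.Prime, (1 - h p) / (p : ℝ) * Real.log p ≤
      (if (p : ℝ) ≤ z then Real.log p / p else 0) + 4 / L * Real.log p +
        (if z < p ∧ (p : ℝ) ≤ L / 4 then Real.log L * (sieveWeight h p / p) else 0) := by
    intro p hp
    obtain ⟨hp1, hpp⟩ := Finset.mem_filter.1 hp
    have hp0 : (0 : ℝ) < p := by exact_mod_cast hpp.pos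
    have hlog : 0 ≤ Real.log p := Real.log_natCast_nonneg p
    have hpL : (p : ℝ) ≤ L := (Nat.le_floor_iff (by linarith)).1 (Finset.mem_Icc.1 hp1).2
    have hle : (1 - h p) / (p : ℝ) * Real.log p ≤ Real.log p / p := by
      rw [div_mul_eq_mul_div]
      gcongr
      exact mul_le_of_le_one_left hlog (by linarith [(hh p).1])
    have h4 : 0 ≤ 4 / L * Real.log p := by positivity
    by_cases h1 : (p : ℝ) ≤ z
    · rw [if_pos h1, if_neg (fun h => absurd h.1 (not_lt.2 h1))]
      linarith
    · rw [if_neg h1]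
      by_cases h2 : (p : ℝ) ≤ L / 4
      · rw [if_pos ⟨not_le.1 h1, h2⟩]
        have hκ := one_sub_le_sieveWeight hh hpp
        have : (1 - h p) / (p : ℝ) * Real.log p ≤ Real.log L * (sieveWeight h p / p) := by
          rw [mul_comm]
          refine mul_le_mul (Real.log_le_log hp0 hpL) (by gcongr)
            (div_nonneg (by linarith [(hh p).2]) hp0.le) hlogL.le
        linarith
      · rw [if_neg (fun h => h2 h.2)]
        have : Real.log p / p ≤ 4 / L * Real.log p := by
          rw [div_mul_eq_mul_div, div_le_div_iff₀ hp0 (by linarith)]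
          nlinarith
        linarith
  have hsum := hα.trans (Finset.sum_le_sum hterm)
  rw [Finset.sum_add_distrib, Finset.sum_add_distrib, ← Finset.sum_filter, ← Finset.sum_filter,
    ← Finset.mul_sum, ← Finset.mul_sum] at hsum
  have hsmall : ∑ p ∈ ((Finset.Icc 1 ⌊L⌋₊).filter Nat.Prime).filter (fun p : ℕ => (p : ℝ) ≤ z),
      Real.log p / p ≤ η * Real.log L + Real.log 4 := by
    calc _ ≤ ∑ p ∈ Finset.Icc 1 ⌊z⌋₊ with p.Prime, Real.log p / p := by
          refine Finset.sum_le_sum_of_subset_of_nonneg ?_ fun p _ _ =>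
            div_nonneg (Real.log_natCast_nonneg p) (Nat.cast_nonneg p)
          intro p hp
          simp only [Finset.mem_filter, Finset.mem_Icc] at hp ⊢
          exact ⟨⟨hp.1.1.1, Nat.le_floor hp.2⟩, hp.1.2⟩
      _ ≤ Real.log ⌊z⌋₊ + Real.log 4 := sum_log_div_primes_le hzf
      _ ≤ Real.log z + Real.log 4 := by
          gcongr
          exact Nat.floor_le (by linarith)
      _ = _ := by rw [hz, Real.log_exp]
  have hlarge : 4 / L * ∑ p ∈ Finset.Icc 1 ⌊L⌋₊ with p.Prime, Real.log p ≤ 4 * Real.log 4 := by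
    calc _ ≤ 4 / L * (Real.log 4 * L) := by
          gcongr
          exact sum_log_primes_le (by linarith)
      _ = _ := by field_simp
  have h3 : 3 * (η * Real.log L) ≤ α * Real.log L := by rw [← mul_assoc]; gcongr
  have := log_four_lt
  rw [sievePrimes]
  refine le_of_mul_le_mul_left ?_ hlogL
  linarith

theorem sum_one_div_sievePrimes_le {L η : ℝ} (hL : 4 ≤ L) (hη : 0 < η) :
    ∑ p ∈ sievePrimes L η, 1 / (p : ℝ) ≤ 2 / η := by
  have hlog4 : Real.log 4 ≤ Real.log L := Real.log_le_log (by norm_num) hL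
  have hlogL : 0 < Real.log L := Real.log_pos (by linarith)
  have hfl : 0 < ⌊L⌋₊ := Nat.floor_pos.2 (by linarith)
  calc ∑ p ∈ sievePrimes L η, 1 / (p : ℝ)
      ≤ ∑ p ∈ sievePrimes L η, (1 / (η * Real.log L)) * (Real.log p / p) := by
        refine Finset.sum_le_sum fun p hp => ?_
        obtain ⟨hpp, hzp, _⟩ := mem_sievePrimes hp
        have hp0 : (0 : ℝ) < p := by exact_mod_cast hpp.pos
        have hle : η * Real.log L ≤ Real.log p := (Real.le_log_iff_exp_le hp0).2 hzp.le
        rw [← mul_div_assoc]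
        gcongr
        rw [one_div_mul_eq_div, one_le_div (by positivity)]
        exact hle
    _ = (1 / (η * Real.log L)) * ∑ p ∈ sievePrimes L η, Real.log p / p := by rw [Finset.mul_sum]
    _ ≤ (1 / (η * Real.log L)) * ∑ p ∈ Finset.Icc 1 ⌊L⌋₊ with p.Prime, Real.log p / p := by
        gcongr
        exact Finset.filter_subset _ _
    _ ≤ (1 / (η * Real.log L)) * (2 * Real.log L) := by
        gcongr
        refine (sum_log_div_primes_le hfl).trans ?_
        have : Real.log ⌊L⌋₊ ≤ Real.log L :=
          Real.log_le_log (by exact_mod_cast hfl) (Nat.floor_le (by linarith))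
        linarith
    _ = 2 / η := by field_simp

theorem prod_le_exp_of_subset_sievePrimes {L η : ℝ} (hL : 0 ≤ L) {T : Finset ℕ}
    (hT : T ⊆ sievePrimes L η) : ((∏ p ∈ T, p : ℕ) : ℝ) ≤ Real.exp (2 / 5 * L) := by
  have hpos : (0 : ℝ) < (∏ p ∈ T, p : ℕ) := by
    exact_mod_cast Finset.prod_pos fun p hp => (mem_sievePrimes (hT hp)).1.pos
  rw [← Real.log_le_iff_le_exp hpos]
  push_cast
  rw [Real.log_prod (fun p hp => by exact_mod_cast (mem_sievePrimes (hT hp)).1.ne_zero)]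
  calc ∑ p ∈ T, Real.log p ≤ ∑ p ∈ Finset.Icc 1 ⌊L / 4⌋₊ with p.Prime, Real.log p := by
        refine Finset.sum_le_sum_of_subset_of_nonneg ?_ fun p _ _ => Real.log_natCast_nonneg p
        intro p hp
        obtain ⟨hpp, _, hpL⟩ := mem_sievePrimes (hT hp)
        rw [Finset.mem_filter, Finset.mem_Icc]
        exact ⟨⟨hpp.one_le, Nat.le_floor hpL⟩, hpp⟩
    _ ≤ Real.log 4 * (L / 4) := sum_log_primes_le (by linarith)
    _ ≤ 2 / 5 * L := by nlinarith [log_four_lt]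

theorem prod_primes_le_exp_mul_totient {T : Finset ℕ} (hT : ∀ p ∈ T, p.Prime) :
    ((∏ p ∈ T, p : ℕ) : ℝ) ≤ Real.exp (2 * ∑ p ∈ T, 1 / (p : ℝ)) * (∏ p ∈ T, p).totient := by
  have hq : 0 < ∏ p ∈ T, p := Finset.prod_pos fun p hp => (hT p hp).pos
  have htot : (∏ p ∈ T, p).totient = ∏ p ∈ T, (p - 1) := by
    have := Nat.totient_mul_prod_primeFactors (∏ p ∈ T, p)
    rw [Nat.primeFactors_prod hT, mul_comm] at this
    exact Nat.eq_of_mul_eq_mul_left hq this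
  rw [htot, Finset.mul_sum, Real.exp_sum]
  push_cast
  rw [← Finset.prod_mul_distrib]
  refine Finset.prod_le_prod (fun p _ => Nat.cast_nonneg p) fun p hp => ?_
  have h2 : (2 : ℝ) ≤ p := by exact_mod_cast (hT p hp).two_le
  rw [Nat.cast_sub (hT p hp).one_le, Nat.cast_one]
  have hexp := Real.add_one_le_exp (2 * (1 / (p : ℝ)))
  calc (p : ℝ) ≤ (2 * (1 / (p : ℝ)) + 1) * (p - 1) := by
        have : (2 * (1 / (p : ℝ)) + 1) * (p - 1) = p + 1 - 2 / p := by field_simp; ring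
        have : (2 : ℝ) / p ≤ 1 := (div_le_one (by linarith)).2 h2
        linarith
    _ ≤ _ := by gcongr; linarith

/-! ### Inequalities between the parameters. -/

/-- The slack `25 * η` contributes `25 u log (2u / η ^ 3)`, which absorbs both the rounding of `K`
and the extra factor `exp u`. -/
theorem exp_mul_exp_le_pow {η u : ℝ} {K : ℕ} (hη0 : 0 < η) (hη : η ≤ 1 / 100)
    (hu : 50000 ≤ u) (hK0 : 0 < K) (hK : K ≤ u / η + 2) :
    Real.exp (-(u / η) * (1 + 25 * η) * Real.log (2 * u / η ^ 3)) * Real.exp u ≤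
      (η / (8 * K)) ^ K := by
  have hK' : (0 : ℝ) < K := by exact_mod_cast hK0
  have hu0 : 0 < u := by linarith
  set Λ := Real.log (2 * u / η ^ 3) with hΛ
  have hη3 : η ^ 3 ≤ 1 := pow_le_one₀ hη0.le (by linarith)
  have hΛ1 : 1 ≤ Λ := by
    rw [hΛ, Real.le_log_iff_exp_le (by positivity)]
    refine Real.exp_one_lt_d9.le.trans ?_
    rw [le_div_iff₀ (by positivity)]
    linarith
  have hKle : 8 * K / η ≤ 2 * u / η ^ 3 := by
    calc 8 * K / η ≤ 8 * (u / η + 2) / η := by gcongr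
      _ = (8 * u * η + 16 * η ^ 2) / η ^ 3 := by field_simp; ring
      _ ≤ 2 * u / η ^ 3 := by gcongr; nlinarith
  have hlog : Real.log (8 * K / η) ≤ Λ := Real.log_le_log (by positivity) hKle
  have hpow : (η / (8 * K)) ^ K = Real.exp (K * -Real.log (8 * K / η)) := by
    rw [Real.exp_nat_mul, ← Real.log_inv, inv_div, Real.exp_log (by positivity)]
  rw [hpow, ← Real.exp_add, Real.exp_le_exp]
  have h1 : K * Real.log (8 * K / η) ≤ (u / η + 2) * Λ :=
    (mul_le_mul_of_nonneg_left hlog hK'.le).trans (mul_le_mul_of_nonneg_right hK (by linarith))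
  have h2 : u / η * (1 + 25 * η) = u / η + 25 * u := by field_simp
  rw [neg_mul, neg_mul, h2]
  nlinarith

/-- With `l = log log x`, this keeps the target error at least `x ^ (-1/4)`, so that `4 / m` is
negligible beside it. The crude `log t ≤ t` suffices. -/
theorem exponent_le {η u l : ℝ} (hη0 : 0 < η) (hη : η ≤ 1 / 100) (hηl : 1 / η ≤ l)
    (hu0 : 0 < u) (hu : u ≤ η * Real.exp (η * l / 2)) (hl : 10 * l ^ 2 ≤ Real.exp (l / 2)) :
    u / η * (1 + 25 * η) * Real.log (2 * u / η ^ 3) ≤ Real.exp l / 4 := by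
  have hl0 : 0 < l := lt_of_lt_of_le (by positivity) hηl
  have hlog : Real.log (2 * u / η ^ 3) ≤ 2 * u / η ^ 3 := by
    have := Real.log_le_sub_one_of_pos (x := 2 * u / η ^ 3) (by positivity)
    linarith
  have hue : u / η ≤ Real.exp (l / 4) := by
    rw [div_le_iff₀ hη0, mul_comm]
    refine hu.trans ?_
    gcongr ?_ * Real.exp ?_
    nlinarith
  calc u / η * (1 + 25 * η) * Real.log (2 * u / η ^ 3)
      ≤ u / η * (1 + 25 * η) * (2 * u / η ^ 3) := by gcongr
    _ ≤ u / η * (5 / 4) * (2 * u / η ^ 3) := by gcongr; linarith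
    _ = 5 / 2 * (u / η) ^ 2 * (1 / η) ^ 2 := by field_simp; ring
    _ ≤ 5 / 2 * Real.exp (l / 4) ^ 2 * l ^ 2 := by gcongr
    _ = Real.exp (l / 2) * (10 * l ^ 2) / 4 := by
        rw [← Real.exp_nat_mul]; push_cast; ring_nf
    _ ≤ Real.exp (l / 2) * Real.exp (l / 2) / 4 := by gcongr
    _ = Real.exp l / 4 := by rw [← Real.exp_add, add_halves]

theorem pos_and_one_div_le {η l : ℝ} (hl2000 : 2000 ≤ l) (hηl : 20 * Real.log l ≤ η * l) :
    0 < η ∧ 1 / η ≤ l ∧ 20 ≤ η * l := by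
  have hlogl : 1 ≤ Real.log l := by
    rw [Real.le_log_iff_exp_le (by linarith)]
    linarith [Real.exp_one_lt_d9]
  have hη0 : 0 < η := pos_of_mul_pos_left (by linarith) (by linarith : 0 ≤ l)
  refine ⟨hη0, ?_, by linarith⟩
  rw [div_le_iff₀ hη0]
  linarith

theorem large_of_five_div_sq_le {η u : ℝ} (hη0 : 0 < η) (hη : η ≤ 1 / 100)
    (hu : 5 / η ^ 2 ≤ u) : 50000 ≤ u ∧ 4 / η + 1 ≤ u := by
  constructor <;> refine le_trans ?_ hu <;> rw [le_div_iff₀ (by positivity)]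
  · nlinarith
  · have : (4 / η + 1) * η ^ 2 = 4 * η + η ^ 2 := by field_simp
    nlinarith

theorem mul_le_exp_div_four {η u l : ℝ} (hη : η ≤ 1 / 100) (hl0 : 1 ≤ l)
    (hu : u ≤ η * Real.exp (η * l / 2)) (hl : 10 * l ^ 2 ≤ Real.exp (l / 2)) :
    l * u ≤ Real.exp l / 4 := by
  have hue : u ≤ l * Real.exp (l / 2) := by
    refine hu.trans (mul_le_mul (by linarith) (Real.exp_le_exp.2 ?_) (Real.exp_pos _).le
      (by linarith))
    nlinarith
  have hpos := Real.exp_pos (l / 2)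
  calc l * u ≤ l * (l * Real.exp (l / 2)) := by gcongr
    _ = (10 * l ^ 2) * Real.exp (l / 2) / 10 := by ring
    _ ≤ Real.exp (l / 2) * Real.exp (l / 2) / 10 := by gcongr
    _ = Real.exp l / 10 := by rw [← Real.exp_add, add_halves]
    _ ≤ Real.exp l / 4 := by linarith [Real.exp_pos l]

theorem four_div_le_exp_half {η l : ℝ} (hl2000 : 2000 ≤ l) (hηl : 20 * Real.log l ≤ η * l) :
    4 / η ≤ Real.exp (η * l / 2) ∧ l ^ 2 ≤ Real.exp (η * l / 2) := by
  obtain ⟨hη0, hηinv, -⟩ := pos_and_one_div_le hl2000 hηl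
  have hlogl : 0 ≤ Real.log l := Real.log_nonneg (by linarith)
  have hsl : l ^ 2 ≤ Real.exp (η * l / 2) := by
    rw [← Real.log_le_iff_le_exp (by positivity), Real.log_pow]
    push_cast
    linarith
  refine ⟨?_, hsl⟩
  have : 4 / η = 4 * (1 / η) := by ring
  nlinarith

/-! ### Choice of the moduli and the contradiction. -/

theorem exists_sievePrimes_large_dev {h : ArithmeticFunction ℝ}
    (hh : ∀ n, 0 ≤ h n ∧ h n ≤ 1) {L l α η u : ℝ} (hlL : Real.log L = l) (hL : 1 < L)
    (hl2000 : 2000 ≤ l)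
    (hα : α * l ≤ ∑ p ∈ Finset.Icc 1 ⌊L⌋₊ with p.Prime, (1 - h p) / (p : ℝ) * Real.log (p : ℝ))
    (hη : η ≤ 1 / 100) (hηα : 3 * η ≤ α) (hηl : 20 * Real.log l ≤ η * l)
    (hu1 : 5 / η ^ 2 ≤ u) (hu2 : u ≤ η * Real.exp (η * l / 2)) {N : ℕ} (hN0 : 0 < N)
    (hN : (N : ℝ) ≤ 2 * Real.exp (l * u)) :
    ∃ T ⊆ sievePrimes L η,
      Real.exp (-(u / η) * (1 + 25 * η) * Real.log (2 * u / η ^ 3)) * Real.exp u ≤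
        |sieveDev (sieveWeight h) N T| / N := by
  obtain ⟨hη0, hηinv, hηl20⟩ := pos_and_one_div_le hl2000 hηl
  obtain ⟨hu5, -⟩ := large_of_five_div_sq_le hη0 hη hu1
  obtain ⟨hs4, hsl⟩ := four_div_le_exp_half hl2000 hηl
  have hss : Real.exp (η * l / 2) * Real.exp (η * l / 2) = Real.exp (η * l) := by
    rw [← Real.exp_add, add_halves]
  have hu0 : 0 < u := by linarith
  have huη : 0 ≤ u / η := by positivity
  have hus : u / η ≤ Real.exp (η * l / 2) := by rw [div_le_iff₀ hη0]; linarith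
  have hs1 : 2 ≤ Real.exp (η * l / 2) := by nlinarith
  have hN0' : (0 : ℝ) < N := by exact_mod_cast hN0
  -- The extra 1 beyond `u / η` gives a spare factor `exp (η * l)`, covering the 2 in the bound for
  -- `N`.
  obtain ⟨K, hK0, hKle, hKge⟩ : ∃ K : ℕ, 0 < K ∧ (K : ℝ) ≤ u / η + 2 ∧ u / η + 1 ≤ K := by
    refine ⟨⌊u / η⌋₊ + 2, by omega, ?_, ?_⟩ <;> push_cast
    · linarith [Nat.floor_le huη]
    · linarith [Nat.lt_floor_add_one (u / η)]
  have hKz : 2 * K / η ≤ Real.exp (η * l) := by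
    rw [← hss]
    calc 2 * K / η ≤ 2 * (2 * Real.exp (η * l / 2)) / η := by gcongr; linarith
      _ = 4 / η * Real.exp (η * l / 2) := by ring
      _ ≤ _ := by gcongr
  have hNz : (N : ℝ) ≤ Real.exp (η * l) ^ K := by
    have h2 : 2 ≤ Real.exp (η * l) := by linarith [Real.add_one_le_exp (η * l)]
    calc (N : ℝ) ≤ 2 * Real.exp (l * u) := hN
      _ ≤ Real.exp (η * l) * Real.exp (l * u) := by gcongr
      _ = Real.exp (η * l * (u / η + 1)) := by
          rw [← Real.exp_add]; congr 1; field_simp; ring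
      _ ≤ Real.exp (K * (η * l)) := by
          rw [mul_comm (K : ℝ)]
          exact Real.exp_le_exp.2 (mul_le_mul_of_nonneg_left hKge (by linarith))
      _ = _ := Real.exp_nat_mul _ _
  obtain ⟨T, hTP, hdev⟩ := exists_subset_le_abs_sieveDev (sieveWeight h) (sieveWeight_le_one hh)
    (sievePrimes L η) (z := Real.exp (η * l))
    (fun p hp => ⟨(mem_sievePrimes hp).1, by rw [← hlL]; exact (mem_sievePrimes hp).2.1⟩)
    (Real.one_le_exp (by linarith)) hK0 hNz hη0 (by linarith)
    (le_sum_sieveWeight_div hh hL hη0 hηα (by rw [hlL]; exact hηl20) (by rw [hlL]; exact hα)) hKz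
  refine ⟨T, hTP, ?_⟩
  rw [le_div_iff₀ hN0', mul_comm]
  exact (mul_le_mul_of_nonneg_left (exp_mul_exp_le_pow hη0 hη hu5 hK0 hKle) hN0'.le).trans hdev

theorem exists_prime_mul_le_quarter {x : ℝ} {N : ℕ} (hN : 0 < N) (hx : 1 ≤ x / (8 * N)) :
    ∃ m : ℕ, m.Prime ∧ x / (8 * N) < m ∧ (m : ℝ) * N ≤ x / 4 := by
  have hN0 : (0 : ℝ) < N := by exact_mod_cast hN
  obtain ⟨m, hm, hnm, hm2⟩ := Nat.exists_prime_lt_and_le_two_mul ⌊x / (8 * N)⌋₊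
    (Nat.floor_pos.2 hx).ne'
  refine ⟨m, hm, (Nat.floor_lt (by linarith)).1 hnm, ?_⟩
  have h2 : (m : ℝ) ≤ 2 * ⌊x / (8 * N)⌋₊ := by exact_mod_cast hm2
  have h3 := Nat.floor_le (show 0 ≤ x / (8 * (N : ℝ)) by linarith)
  calc (m : ℝ) * N ≤ 2 * (x / (8 * N)) * N := by gcongr; linarith
    _ = x / 4 := by field_simp; ring

/-- The Maier matrix inequality with the number of rows chosen as `⌊x / 4q⌋ + 1`. -/
theorem abs_sieveDev_le_of_wellDistributed_of_prime {a : ℕ → ℝ} {h : ArithmeticFunction ℝ}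
    (hh : ∀ n, 0 ≤ h n ∧ h n ≤ 1) (h1 : h.IsMultiplicative) {T : Finset ℕ}
    (hT : ∀ p ∈ T, p.Prime) {m N : ℕ} (hm : m.Prime) (hmT : ∀ p ∈ T, m.Coprime p) {x G B : ℝ}
    (hx : 0 < x) (hG : 0 ≤ G) (hA : 0 < seqSum a x) (hN : 0 < N)
    (hDm : WellDistributed a h x m (G * (seqSum a x / m.totient)))
    (hDq : WellDistributed a h x (∏ p ∈ T, p) (G * (seqSum a x / (∏ p ∈ T, p).totient)))
    (hxm : x / (8 * N) < m) (hmx : (m : ℝ) * N ≤ x / 4)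
    (hqx : ((∏ p ∈ T, p : ℕ) : ℝ) < x / 8)
    (hqB : ((∏ p ∈ T, p : ℕ) : ℝ) ≤ B * (∏ p ∈ T, p).totient) :
    |sieveDev (sieveWeight h) N T| / N ≤ 4 / m + 2 * G * (16 + 4 * B) := by
  have hq0 : 0 < ∏ p ∈ T, p := Finset.prod_pos fun p hp => (hT p hp).pos
  have hmatrix := fun R hR hR1 hR2 => abs_sieveDev_le_of_wellDistributed (R := R) hh h1 hT hm
    hmT hx hA hN hR hDm hDq hR1 hR2
  generalize (∏ p ∈ T, p) = q at *
  have hq0' : (0 : ℝ) < q := by exact_mod_cast hq0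
  have hN' : (0 : ℝ) < N := by exact_mod_cast hN
  have hφq : (0 : ℝ) < q.totient := by exact_mod_cast Nat.totient_pos.2 hq0
  have hm2 : (2 : ℝ) ≤ m := by exact_mod_cast hm.two_le
  have hmφ : (m : ℝ) / 2 ≤ m.totient := by
    rw [Nat.totient_prime hm, Nat.cast_sub hm.one_le, Nat.cast_one]
    linarith
  have hφm : (0 : ℝ) < m.totient := by linarith
  have hxm' : x < m * (8 * N) := (div_lt_iff₀ (by positivity)).1 hxm
  have hRgt : x / (4 * q) < ((⌊x / (4 * q)⌋₊ + 1 : ℕ) : ℝ) := by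
    push_cast; exact Nat.lt_floor_add_one _
  have hRle : ((⌊x / (4 * q)⌋₊ + 1 : ℕ) : ℝ) ≤ x / (4 * q) + 1 := by
    push_cast; linarith [Nat.floor_le (show 0 ≤ x / (4 * (q : ℝ)) by positivity)]
  replace hmatrix := hmatrix (⌊x / (4 * q)⌋₊ + 1) (Nat.succ_pos _)
  generalize ⌊x / (4 * q)⌋₊ + 1 = R at *
  have hRq : x / 4 < R * q := by
    rw [div_lt_iff₀ (by positivity)] at hRgt
    linarith
  have hRq' : (R : ℝ) * q ≤ x / 4 + q := by
    calc (R : ℝ) * q ≤ (x / (4 * q) + 1) * q := by gcongr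
      _ = x / 4 + q := by field_simp
  refine (hmatrix (by push_cast; exact hRq) (by push_cast; linarith)).trans ?_
  have hR0 : (0 : ℝ) < R := lt_trans (by positivity) hRgt
  -- Uses `m * N > x / 8` and `φ(m) ≥ m / 2`.
  have e1 : x / (N * m.totient) ≤ 16 := by
    rw [div_le_iff₀ (by positivity)]
    have := mul_le_mul_of_nonneg_left hmφ hN'.le
    linarith
  have e2 : x / (R * q.totient) ≤ 4 * B := by
    rw [div_le_iff₀ (by positivity)]
    have := mul_le_mul_of_nonneg_left hqB hR0.le
    linarith
  gcongr

theorem not_forall_wellDistributed {a : ℕ → ℝ} {h : ArithmeticFunction ℝ}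
    (hh : ∀ n, 0 ≤ h n ∧ h n ≤ 1) (h1 : h.IsMultiplicative) {S : Finset ℕ} {x L l : ℝ}
    (hLx : Real.log x = L) (hlL : Real.log L = l) (hx : 0 < x) (hL : 0 < L)
    (hl2000 : 2000 ≤ l) (hl : 10 * l ^ 2 ≤ Real.exp (l / 2))
    (hS : ∀ p ∈ S, p.Prime ∧ (p : ℝ) ≤ l) {α η u : ℝ}
    (hα : α * l ≤ ∑ p ∈ Finset.Icc 1 ⌊L⌋₊ with p.Prime, (1 - h p) / (p : ℝ) * Real.log (p : ℝ))
    (hη : η ≤ 1 / 100) (hηα : 3 * η ≤ α) (hηl : 20 * Real.log l ≤ η * l)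
    (hu1 : 5 / η ^ 2 ≤ u) (hu2 : u ≤ η * Real.exp (η * l / 2)) (hA : 0 < seqSum a x)
    (hwd : ∀ m : ℕ, 0 < m → (m : ℝ) ≤ x / Real.exp (l * u) → (∀ p ∈ S, Nat.Coprime m p) →
      WellDistributed a h x m (1 / 100 *
        Real.exp (-(u / η) * (1 + 25 * η) * Real.log (2 * u / η ^ 3)) *
          (seqSum a x / m.totient))) : False := by
  have hexpl : Real.exp l = L := by rw [← hlL, Real.exp_log hL]
  have hexpL : Real.exp L = x := by rw [← hLx, Real.exp_log hx]
  have hlL' : l + 1 ≤ L := by rw [← hexpl]; exact Real.add_one_le_exp l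
  obtain ⟨hη0, hηinv, hηl20⟩ := pos_and_one_div_le hl2000 hηl
  obtain ⟨hu5, hu4⟩ := large_of_five_div_sq_le hη0 hη hu1
  have hu0 : 0 < u := by linarith
  have hW := exponent_le hη0 hη hηinv hu0 hu2 hl
  have hlu := mul_le_exp_div_four hη (by linarith) hu2 hl
  rw [hexpl] at hW hlu
  have hlu0 : 1 ≤ Real.exp (l * u) := Real.one_le_exp (by nlinarith)
  have hlu4 : Real.exp (l * u) ≤ Real.exp (L / 4) := Real.exp_le_exp.2 hlu
  have hNge : Real.exp (l * u) ≤ ⌈Real.exp (l * u)⌉₊ := Nat.le_ceil _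
  have hNle : (⌈Real.exp (l * u)⌉₊ : ℝ) ≤ 2 * Real.exp (l * u) := by
    linarith [Nat.ceil_lt_add_one (Real.exp_pos (l * u)).le]
  generalize ⌈Real.exp (l * u)⌉₊ = N at hNge hNle
  have hN0' : (0 : ℝ) < N := by linarith
  have hN0 : 0 < N := by exact_mod_cast hN0'
  obtain ⟨T, hTP, hdev⟩ := exists_sievePrimes_large_dev hh hlL (by linarith) hl2000 hα hη hηα
    hηl hu1 hu2 hN0 hNle
  have hT : ∀ p ∈ T, p.Prime ∧ Real.exp (η * l) < p ∧ (p : ℝ) ≤ L / 4 := fun p hp => by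
    rw [← hlL]; exact mem_sievePrimes (hTP hp)
  have hTprime : ∀ p ∈ T, p.Prime := fun p hp => (hT p hp).1
  have hqle := prod_le_exp_of_subset_sievePrimes hL.le hTP
  have hqφ : ((∏ p ∈ T, p : ℕ) : ℝ) ≤ Real.exp (4 / η) * (∏ p ∈ T, p).totient := by
    refine (prod_primes_le_exp_mul_totient hTprime).trans ?_
    refine mul_le_mul_of_nonneg_right (Real.exp_le_exp.2 ?_) (Nat.cast_nonneg _)
    have hle : ∑ p ∈ T, 1 / (p : ℝ) ≤ 2 / η :=
      (Finset.sum_le_sum_of_subset_of_nonneg hTP fun p _ _ => by positivity).trans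
        (sum_one_div_sievePrimes_le (by linarith) hη0)
    calc 2 * ∑ p ∈ T, 1 / (p : ℝ) ≤ 2 * (2 / η) := by gcongr
      _ = 4 / η := by ring
  have hxN : L < x / (8 * N) := by
    have hq := Real.quadratic_le_exp_of_nonneg (show 0 ≤ L / 2 by positivity)
    have h16 : 16 * L < Real.exp (L / 2) := by nlinarith
    rw [lt_div_iff₀ (by positivity)]
    calc L * (8 * N) ≤ L * (8 * (2 * Real.exp (L / 4))) := by gcongr; linarith
      _ = 16 * L * Real.exp (L / 4) := by ring
      _ < Real.exp (L / 2) * Real.exp (L / 4) := by gcongr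
      _ = Real.exp (L / 2 + L / 4) := by rw [Real.exp_add]
      _ ≤ Real.exp L := Real.exp_le_exp.2 (by linarith)
      _ = x := hexpL
  obtain ⟨m, hm, hmge, hmle⟩ := exists_prime_mul_le_quarter hN0 (by linarith)
  have hm0 : (0 : ℝ) < m := by exact_mod_cast hm.pos
  have hmM : (m : ℝ) ≤ x / Real.exp (l * u) := by
    rw [le_div_iff₀ (by positivity)]
    have := mul_le_mul_of_nonneg_left hNge hm0.le
    linarith
  -- The prime `m` exceeds `log x`, hence differs from all primes of `S` and of `T`.
  have hcop : ∀ p : ℕ, p.Prime → (p : ℝ) ≤ L → m.Coprime p := fun p hp hpL => by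
    rw [Nat.coprime_primes hm hp]
    rintro rfl
    linarith
  have hwm := hwd m hm.pos hmM fun p hp => hcop p (hS p hp).1 (by linarith [(hS p hp).2])
  have hqM : ((∏ p ∈ T, p : ℕ) : ℝ) ≤ x / Real.exp (l * u) := by
    rw [← hexpL, ← Real.exp_sub]
    exact hqle.trans (Real.exp_le_exp.2 (by linarith))
  -- Primes of `T` exceed `(log x) ^ η > log log x`, so `q` is coprime to `S`.
  have hlz : l < Real.exp (η * l) := by
    have h2 := (four_div_le_exp_half hl2000 hηl).2
    have h3 : Real.exp (η * l / 2) ≤ Real.exp (η * l) := Real.exp_le_exp.2 (by linarith)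
    nlinarith
  have hwq := hwd (∏ p ∈ T, p) (Finset.prod_pos fun p hp => (hTprime p hp).pos) hqM fun p hp => by
    refine Nat.Coprime.prod_left fun r hr => ?_
    rw [Nat.coprime_primes (hT r hr).1 (hS p hp).1]
    rintro rfl
    linarith [(hS r hp).2, (hT r hr).2.1]
  have hq8 : ((∏ p ∈ T, p : ℕ) : ℝ) < x / 8 := by
    have h2 : 8 < Real.exp (3 / 5 * L) := by linarith [Real.add_one_le_exp (3 / 5 * L)]
    have h3 : Real.exp (2 / 5 * L) * Real.exp (3 / 5 * L) = x := by
      rw [← Real.exp_add, ← hexpL]; congr 1; ring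
    have := mul_lt_mul_of_pos_left h2 (Real.exp_pos (2 / 5 * L))
    linarith
  have hE0 := Real.exp_pos (-(u / η) * (1 + 25 * η) * Real.log (2 * u / η ^ 3))
  have hmatrix := abs_sieveDev_le_of_wellDistributed_of_prime hh h1 hTprime hm
    (fun p hp => hcop p (hTprime p hp) (by linarith [(hT p hp).2.2])) hx
    (by positivity) hA hN0 hwm hwq hmge hmle hq8 hqφ
  have hEge : Real.exp (-(L / 4)) ≤
      Real.exp (-(u / η) * (1 + 25 * η) * Real.log (2 * u / η ^ 3)) := by
    rw [Real.exp_le_exp, neg_mul, neg_mul]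
    linarith
  generalize Real.exp (-(u / η) * (1 + 25 * η) * Real.log (2 * u / η ^ 3)) = E at *
  have hmE : 4 / (m : ℝ) ≤ E := by
    refine le_trans ?_ hEge
    have h64 : 64 ≤ Real.exp (L / 2) := by linarith [Real.add_one_le_exp (L / 2)]
    have hxe : x = Real.exp (L / 2) * Real.exp (L / 4) * Real.exp (L / 4) := by
      rw [← Real.exp_add, ← Real.exp_add, ← hexpL]; congr 1; ring
    have hpos := Real.exp_pos (L / 4)
    have hm16 : x ≤ 16 * m * Real.exp (L / 4) := by
      calc x ≤ m * (8 * N) := ((div_lt_iff₀ (by positivity)).1 hmge).le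
        _ ≤ m * (8 * (2 * Real.exp (L / 4))) := by gcongr; linarith
        _ = _ := by ring
    rw [hxe] at hm16
    have h4 := le_of_mul_le_mul_right hm16 hpos
    have h5 := mul_le_mul_of_nonneg_right h64 hpos.le
    rw [Real.exp_neg, div_le_iff₀ hm0, ← div_eq_inv_mul, le_div_iff₀ hpos]
    linarith
  have hfin : E * Real.exp u ≤
      E * (1 + 2 * (1 / 100) * (16 + 4 * Real.exp (4 / η))) := by
    linarith [hdev.trans hmatrix]
  have hfin' := le_of_mul_le_mul_left hfin hE0
  have h4η : 1 ≤ Real.exp (4 / η) := Real.one_le_exp (by positivity)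
  have hexpu : Real.exp (4 / η) * 2 ≤ Real.exp u := by
    refine le_trans ?_ (Real.exp_le_exp.2 hu4)
    rw [Real.exp_add]
    exact mul_le_mul_of_nonneg_left (by linarith [Real.add_one_le_exp 1]) (by linarith)
  linarith

theorem eventually_large_logs : ∀ᶠ x : ℝ in Filter.atTop,
    2000 ≤ Real.log (Real.log x) ∧
    2000 * Real.log (Real.log (Real.log x)) ≤ Real.log (Real.log x) ∧
    10 * Real.log (Real.log x) ^ 2 ≤ Real.exp (Real.log (Real.log x) / 2) := by
  have hlog : Filter.Tendsto (fun x : ℝ => Real.log (Real.log x)) Filter.atTop Filter.atTop :=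
    Real.tendsto_log_atTop.comp Real.tendsto_log_atTop
  have h1 : ∀ᶠ l : ℝ in Filter.atTop, 2000 ≤ l ∧ 2000 * Real.log l ≤ l ∧
      10 * l ^ 2 ≤ Real.exp (l / 2) := by
    refine (Filter.eventually_ge_atTop 2000).and (Filter.Eventually.and ?_ ?_)
    · filter_upwards [Real.isLittleO_log_id_atTop.bound (show (0 : ℝ) < 1 / 2000 by norm_num),
        Filter.eventually_ge_atTop 1] with l hl hl1
      rw [Real.norm_eq_abs, id, Real.norm_eq_abs, abs_of_nonneg (Real.log_nonneg hl1),
        abs_of_nonneg (by linarith)] at hl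
      linarith
    · filter_upwards [((Real.tendsto_exp_div_pow_atTop 2).comp
        (Filter.tendsto_id.atTop_div_const (show (0 : ℝ) < 2 by norm_num))).eventually_ge_atTop 40,
        Filter.eventually_gt_atTop 0] with l hl hl0
      simp only [Function.comp_apply, id] at hl
      rw [le_div_iff₀ (by positivity)] at hl
      linarith
  exact hlog.eventually h1

theorem corollary1p3 :
    ∃ c : ℝ, 0 < c ∧ ∃ x₀ : ℝ, ∀ x : ℝ, x₀ ≤ x →
      ∀ (a : ℕ → ℝ) (S : Finset ℕ) (h : ArithmeticFunction ℝ),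
        (∀ n, 1 ≤ n → 0 ≤ a n) →
        (∀ p ∈ S, p.Prime ∧ (p : ℝ) ≤ Real.log (Real.log x)) →
        h.IsMultiplicative →
        (∀ n, 0 ≤ h n ∧ h n ≤ 1) →
        ∀ α : ℝ,
          60 * Real.log (Real.log (Real.log x)) / Real.log (Real.log x) ≤ α →
          α * Real.log (Real.log x) ≤
            ∑ p ∈ Finset.Icc 1 ⌊Real.log x⌋₊ with p.Prime,
              (1 - h p) / (p : ℝ) * Real.log (p : ℝ) →
          ∀ η : ℝ, η = min (α / 3) (1 / 100) →
          ∀ u : ℝ, 5 / η ^ 2 ≤ u → u ≤ η * (Real.log x) ^ (η / 2) →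
            ∃ y : ℝ, x / 4 < y ∧ y < x ∧
              ∃ l b : ℕ, 0 < l ∧ (l : ℝ) ≤ x / (Real.log x) ^ u ∧
                (∀ p ∈ S, Nat.Coprime l p) ∧
                c * (Real.exp (-(u / η) * (1 + 25 * η) * Real.log (2 * u / η ^ 3)) *
                    (seqSum a x / (Nat.totient l : ℝ))) ≤
                  |seqSumAP a y l b -
                    fRes h l b / ((l : ℝ) * gammaFactor h l) * (y * (seqSum a x / x))| := by
  obtain ⟨x₀, hx₀⟩ := Filter.eventually_atTop.1 eventually_large_logs
  refine ⟨1 / 100, by norm_num, max x₀ 1, ?_⟩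
  intro x hx a S h _ hS h1 hh α hα hsum η hη u hu1 hu2
  obtain ⟨hl1, hl2, hl3⟩ := hx₀ x ((le_max_left _ _).trans hx)
  have hx0 : 0 < x := lt_of_lt_of_le one_pos ((le_max_right _ _).trans hx)
  have hL0 : 0 ≤ Real.log x := Real.log_nonneg ((le_max_right _ _).trans hx)
  have hL : 0 < Real.log x := by
    -- By the convention `Real.log 0 = 0`, `log x = 0` would force `log log x = 0`.
    refine hL0.lt_of_ne fun h0 => ?_
    rw [← h0, Real.log_zero] at hl1
    linarith
  have hl0 : 0 < Real.log (Real.log x) := by linarith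
  have hηα : 3 * η ≤ α := by
    have := min_le_left (α / 3) (1 / 100)
    linarith
  have hηl : 20 * Real.log (Real.log (Real.log x)) ≤ η * Real.log (Real.log x) := by
    rw [div_le_iff₀ hl0] at hα
    rcases min_choice (α / 3) (1 / 100) with hm | hm <;> rw [hη, hm] <;> linarith
  have hLpow : ∀ v : ℝ, Real.log x ^ v = Real.exp (Real.log (Real.log x) * v) := fun v =>
    Real.rpow_def_of_pos hL v
  have hη100 : η ≤ 1 / 100 := hη ▸ min_le_right _ _
  have hu2' : u ≤ η * Real.exp (η * Real.log (Real.log x) / 2) := by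
    rw [hLpow] at hu2
    convert hu2 using 3
    ring
  rw [hLpow]
  by_contra! hcon
  have hwd : ∀ m : ℕ, 0 < m → (m : ℝ) ≤ x / Real.exp (Real.log (Real.log x) * u) →
      (∀ p ∈ S, Nat.Coprime m p) → ∀ y : ℝ, ∀ b : ℕ, x / 4 < y → y < x →
        |seqSumAP a y m b - fRes h m b / ((m : ℝ) * gammaFactor h m) * (y * (seqSum a x / x))| <
          1 / 100 * Real.exp (-(u / η) * (1 + 25 * η) * Real.log (2 * u / η ^ 3)) *
            (seqSum a x / m.totient) := by
    intro m hm0 hm hmS y b hy1 hy2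
    rw [mul_assoc]
    exact hcon y hy1 hy2 m b hm0 hm hmS
  refine not_forall_wellDistributed (a := a) hh h1 rfl rfl hx0 hL hl1 hl3 hS hsum
    hη100 hηα hηl hu1 hu2' ?_
    fun m hm0 hm hmS y b hy1 hy2 => (hwd m hm0 hm hmS y b hy1 hy2).le
  have hux : Real.exp (Real.log (Real.log x) * u) ≤ x := by
    refine le_of_le_of_eq (Real.exp_le_exp.2 ?_) (Real.exp_log hx0)
    have := mul_le_exp_div_four hη100 (by linarith) hu2' hl3
    rw [Real.exp_log hL] at this
    linarith
  -- Positivity of `𝒜(x)` comes from the strict negated inequality at modulus 1: a nonnegative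
  -- quantity lies below a positive multiple of `𝒜(x)`.
  have hone := (abs_nonneg _).trans_lt (hwd 1 one_pos
    (by rw [Nat.cast_one]; exact (one_le_div (Real.exp_pos _)).2 hux)
    (fun p _ => Nat.coprime_one_left p) (x / 2) 0 (by linarith) (by linarith))
  rw [Nat.totient_one, Nat.cast_one, div_one] at hone
  exact pos_of_mul_pos_right hone (by positivity)
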